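/- Let $(E,d)$ be a non-empty complete separable metric space whose distance $d$ is bounded by $1$, equipped with its Borel $\sigma$-algebra, and let $P$ be a Markov kernel on $E$. Let $Q$ be a coupling kernel for $P$, i.e. a Markov kernel on $E\times E$ such that for all $x,y\in E$ the marginals of $Q((x,y),\cdot)$ are $P(x,\cdot)$ and $P(y,\cdot)$. Let $\Delta\subseteq E\times E$ be measurable, $\ell\ge 1$ an integer and $\varepsilon>0$, and assume: (A1) $Qd(x,y)\le d(x,y)$ for all $x,y\in E$, and $Q^{\ell}d(x,y)\le(1-\varepsilon)\,d(x,y)$ for all $(x,y)\in\Delta$. (A2) There are a concave increasing function $\phi:[0,\infty)\to[0,\infty)$ with $\lim_{t\to\infty}\phi(t)=\infty$, a measurable function $V:E\to[1,\infty)$ and a constant $b\in\mathbb R$ such that for all $x,y\in E$ $$PV(x)+PV(y)\le V(x)+V(y)-\phi\big(V(x)+V(y)\big)+b\,\mathbf 1_{\Delta}(x,y),$$ and $\sup_{(x,y)\in\Delta}\{V(x)+V(y)\}<\infty$. Then $P$ admits a unique invariant probability measure $\pi$, and $\int_E\phi(V(x))\,\pi(\mathrm dx)<\infty$. -/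

import Mathlib

open MeasureTheory ProbabilityTheory Filter

/-- `Q` is a coupling kernel for the Markov kernel `P`: a Markov kernel on the product space such
that, for all `x, y`, the probability `Q((x, y), ·)` has marginals `P(x, ·)` and `P(y, ·)`. -/
structure IsCouplingKernel {E : Type*} [MeasurableSpace E]
    (P : Kernel E E) (Q : Kernel (E × E) (E × E)) : Prop where
  isMarkovKernel : IsMarkovKernel Q
  map_fst : ∀ x y : E, (Q (x, y)).map Prod.fst = P x
  map_snd : ∀ x y : E, (Q (x, y)).map Prod.snd = P y

/-- The contraction condition on a coupling kernel `Q`: `Q d ≤ d` everywhere, and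
`Q^ℓ d ≤ (1 - ε) d` on the measurable set `Δ`, with `ℓ ≥ 1` and `ε > 0`.
(The power of a kernel is its iterate for composition.) -/
structure ContractionCondition {E : Type*} [MetricSpace E] [MeasurableSpace E]
    (Q : Kernel (E × E) (E × E)) (Δ : Set (E × E)) (ℓ : ℕ) (ε : ℝ) : Prop where
  measurableSet : MeasurableSet Δ
  one_le : 1 ≤ ℓ
  eps_pos : 0 < ε
  weak_contraction : ∀ x y : E, ∫ z, dist z.1 z.2 ∂(Q (x, y)) ≤ dist x y
  contraction : ∀ x y : E, (x, y) ∈ Δ →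
    ∫ z, dist z.1 z.2 ∂((Q ^ ℓ) (x, y)) ≤ (1 - ε) * dist x y

/-- Concave increasing functions `φ : [0, ∞) → [0, ∞)` with `φ(t) → ∞` as `t → ∞`
(the values of `φ` on negative reals are irrelevant). -/
structure IsConcaveRate (φ : ℝ → ℝ) : Prop where
  nonneg : ∀ t, 0 ≤ t → 0 ≤ φ t
  concaveOn : ConcaveOn ℝ (Set.Ici 0) φ
  monotoneOn : MonotoneOn φ (Set.Ici 0)
  tendsto_atTop : Tendsto φ atTop atTop

/-- The double drift condition with constant `b`. The integrals `PV(x)` and `PV(y)` are taken in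
`[0, ∞]`, so their finiteness is part of the inequality. As `V ≥ 1`, the left-hand side is at
least `2`, so the truncation of the right-hand side at `0` by `ENNReal.ofReal` has no effect. -/
structure DoubleDrift {E : Type*} [MeasurableSpace E] (P : Kernel E E)
    (Δ : Set (E × E)) (φ : ℝ → ℝ) (V : E → ℝ) (b : ℝ) : Prop where
  measurableSet : MeasurableSet Δ
  rate : IsConcaveRate φ
  measurable : Measurable V
  one_le : ∀ x, 1 ≤ V x
  drift : ∀ x y : E,
    ∫⁻ z, ENNReal.ofReal (V z) ∂(P x) + ∫⁻ z, ENNReal.ofReal (V z) ∂(P y) ≤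
      ENNReal.ofReal (V x + V y - φ (V x + V y) + b * Δ.indicator (fun _ => (1 : ℝ)) (x, y))
  bddAbove : BddAbove ((fun z : E × E => V z.1 + V z.2) '' Δ)

/-!
Let `d` be the distance and let `U(x, y)` be the sum of the values of a drift function at `x` and
`y`. Under the coupling `Q`, every step spent outside `Δ` decreases `U` on average by a fixed
amount `c > 0`, so that, up to an error of order `U(z) / (c k)`, a pair started from `z` meets `Δ`
within `k` steps, whereupon `d` contracts by the factor `r < 1`. Since `Q^n U ≤ U + nβ` grows only
linearly in `n`, letting `k → ∞` shows that `e = lim_n sup {Q^n d(z) : U(z) ≤ R}` satisfies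
`e ≤ r e`, hence `e = 0`.

Uniqueness follows by coupling two invariant measures. For existence, `Q d ≤ d` makes `P` Feller,
and the drift bounds the Cesàro averages of the laws of the chain started from `x` on a function
`ψ` that is large where the drift function is. The coupling therefore moves most of the mass of
these averages close to the single law `P^n(x, ·)`, which is tight; so the averages are tight, and
their limit points are invariant (Krylov–Bogoliubov).
-/

open scoped ENNReal NNReal Topology BoundedContinuousFunction

section Powers

variable {α : Type*} [MeasurableSpace α]

instance isMarkovKernel_pow (κ : Kernel α α) [IsMarkovKernel κ] (n : ℕ) :
    IsMarkovKernel (κ ^ n) := by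
  induction n with
  | zero => exact inferInstanceAs (IsMarkovKernel Kernel.id)
  | succ n ih => rw [Kernel.pow_add, pow_one]; infer_instance

lemma lintegral_kernel_pow_zero (κ : Kernel α α) {f : α → ℝ≥0∞} (hf : Measurable f) (x : α) :
    ∫⁻ y, f y ∂(κ ^ 0) x = f x := by
  rw [pow_zero, show (1 : Kernel α α) = Kernel.id from rfl, Kernel.id_apply, lintegral_dirac' x hf]

lemma lintegral_kernel_pow_add (κ : Kernel α α) (m n : ℕ) {f : α → ℝ≥0∞} (hf : Measurable f)
    (x : α) : ∫⁻ y, f y ∂(κ ^ (m + n)) x = ∫⁻ z, ∫⁻ y, f y ∂(κ ^ m) z ∂(κ ^ n) x := by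
  rw [Kernel.pow_add, Kernel.lintegral_comp _ _ _ hf]

lemma lintegral_kernel_pow_succ (κ : Kernel α α) (n : ℕ) {f : α → ℝ≥0∞} (hf : Measurable f)
    (x : α) : ∫⁻ y, f y ∂(κ ^ (n + 1)) x = ∫⁻ z, ∫⁻ y, f y ∂(κ ^ n) z ∂κ x := by
  rw [lintegral_kernel_pow_add κ n 1 hf, pow_one]

lemma invariant_pow {κ : Kernel α α} {π : Measure α} (hπ : κ.Invariant π) (n : ℕ) :
    (κ ^ n).Invariant π := by
  induction n with
  | zero => exact Measure.id_comp
  | succ n ih => rw [Kernel.pow_add, pow_one]; exact ih.comp hπ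

lemma lintegral_lintegral_of_invariant {κ : Kernel α α} {π : Measure α} (hπ : κ.Invariant π)
    {f : α → ℝ≥0∞} (hf : Measurable f) : ∫⁻ x, ∫⁻ y, f y ∂κ x ∂π = ∫⁻ x, f x ∂π := by
  conv_rhs => rw [← hπ.def]
  rw [Measure.lintegral_bind κ.aemeasurable hf.aemeasurable]

lemma lintegral_kernel_pow_le_of_drift {κ : Kernel α α} [IsMarkovKernel κ] {W : α → ℝ≥0∞}
    (hW : Measurable W) {β : ℝ≥0∞} (hdrift : ∀ x, ∫⁻ y, W y ∂κ x ≤ W x + β) (n : ℕ) (x : α) :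
    ∫⁻ y, W y ∂(κ ^ n) x ≤ W x + n * β := by
  induction n generalizing x with
  | zero => rw [lintegral_kernel_pow_zero κ hW]; exact le_self_add
  | succ n ih =>
    calc ∫⁻ y, W y ∂(κ ^ (n + 1)) x = ∫⁻ z, ∫⁻ y, W y ∂(κ ^ n) z ∂κ x :=
          lintegral_kernel_pow_succ κ n hW x
      _ ≤ ∫⁻ z, (W z + n * β) ∂κ x := lintegral_mono ih
      _ = ∫⁻ z, W z ∂κ x + n * β := by rw [lintegral_add_right _ measurable_const]; simp
      _ ≤ W x + β + n * β := by gcongr; exact hdrift x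
      _ = W x + (n + 1 : ℕ) * β := by push_cast; ring

lemma sum_lintegral_kernel_pow_le_of_drift {κ : Kernel α α} [IsMarkovKernel κ]
    {W ψ : α → ℝ≥0∞} (hψ : Measurable ψ) {β : ℝ≥0∞}
    (hdrift : ∀ x, ∫⁻ y, W y ∂κ x + ψ x ≤ W x + β) (n : ℕ) (x : α) :
    ∑ k ∈ Finset.range n, ∫⁻ y, ψ y ∂(κ ^ k) x ≤ W x + n * β := by
  induction n generalizing x with
  | zero => simp
  | succ n ih =>
    calc ∑ k ∈ Finset.range (n + 1), ∫⁻ y, ψ y ∂(κ ^ k) x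
        = ∫⁻ z, ∑ k ∈ Finset.range n, ∫⁻ y, ψ y ∂(κ ^ k) z ∂κ x + ψ x := by
          rw [Finset.sum_range_succ', lintegral_kernel_pow_zero κ hψ]
          simp_rw [lintegral_kernel_pow_succ κ _ hψ]
          rw [lintegral_finsetSum _ fun k _ => hψ.lintegral_kernel]
      _ ≤ ∫⁻ z, (W z + n * β) ∂κ x + ψ x := by gcongr with z; exact ih z
      _ = ∫⁻ z, W z ∂κ x + ψ x + n * β := by
          rw [lintegral_add_right _ measurable_const, lintegral_const, measure_univ, mul_one,
            add_right_comm]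
      _ ≤ W x + β + n * β := add_le_add_left (hdrift x) _
      _ = W x + (n + 1 : ℕ) * β := by push_cast; ring

end Powers

section Contraction

variable {α : Type*} [MeasurableSpace α] {κ : Kernel α α} {d U : α → ℝ≥0∞} {Δ : Set α} {ℓ : ℕ}
  {D r c β : ℝ≥0∞}

lemma antitone_lintegral_kernel_pow (hd : Measurable d) (hweak : ∀ z, ∫⁻ w, d w ∂κ z ≤ d z)
    (z : α) : Antitone fun n => ∫⁻ w, d w ∂(κ ^ n) z := by
  refine antitone_nat_of_succ_le fun n => ?_
  rw [add_comm, lintegral_kernel_pow_add κ 1 n hd, pow_one]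
  exact lintegral_mono hweak

/- Each step spent outside `Δ` costs `c` units of `U`, and the first step spent in `Δ` starts
a contraction; so `U z` pays for the starting points from which `Δ` is not met in `k` steps. -/
lemma mul_lintegral_kernel_pow_le [IsMarkovKernel κ] (hd : Measurable d) (hU : Measurable U)
    (hdD : ∀ z, d z ≤ D) (hweak : ∀ z, ∫⁻ w, d w ∂κ z ≤ d z)
    (hcontr : ∀ z ∈ Δ, ∫⁻ w, d w ∂(κ ^ ℓ) z ≤ r * d z)
    (hdrift : ∀ z ∉ Δ, ∫⁻ w, U w ∂κ z + c ≤ U z) (k : ℕ) (z : α) :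
    c * k * ∫⁻ w, d w ∂(κ ^ (ℓ + k)) z ≤ c * k * (r * d z) + D * U z := by
  induction k generalizing z with
  | zero => simp
  | succ k ih =>
    by_cases hz : z ∈ Δ
    · have hcontr' : ∫⁻ w, d w ∂(κ ^ (ℓ + (k + 1))) z ≤ r * d z :=
        (antitone_lintegral_kernel_pow hd hweak z (Nat.le_add_right _ _)).trans (hcontr z hz)
      exact (by gcongr : _ ≤ c * ↑(k + 1) * (r * d z)).trans le_self_add
    · have hleD : ∫⁻ w, d w ∂(κ ^ (ℓ + (k + 1))) z ≤ D := lintegral_le_const (.of_forall hdD)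
      calc c * ↑(k + 1) * ∫⁻ w, d w ∂(κ ^ (ℓ + (k + 1))) z
          = c * k * ∫⁻ w, d w ∂(κ ^ (ℓ + (k + 1))) z + c * ∫⁻ w, d w ∂(κ ^ (ℓ + (k + 1))) z := by
            push_cast; ring
        _ ≤ c * k * ∫⁻ w, d w ∂(κ ^ (ℓ + (k + 1))) z + c * D := by gcongr
        _ = ∫⁻ y, c * k * ∫⁻ w, d w ∂(κ ^ (ℓ + k)) y ∂κ z + c * D := by
            rw [← add_assoc, lintegral_kernel_pow_succ κ _ hd,
              lintegral_const_mul _ hd.lintegral_kernel]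
        _ ≤ ∫⁻ y, (c * k * (r * d y) + D * U y) ∂κ z + c * D := by gcongr with y; exact ih y
        _ = c * k * (r * ∫⁻ y, d y ∂κ z) + D * (∫⁻ y, U y ∂κ z + c) := by
            rw [lintegral_add_right _ (hU.const_mul D), lintegral_const_mul _ (hd.const_mul r),
              lintegral_const_mul _ hd, lintegral_const_mul _ hU]
            ring
        _ ≤ c * ↑(k + 1) * (r * d z) + D * U z := by
            gcongr
            · exact Nat.le_succ k
            · exact hweak z
            · exact hdrift z hz

lemma mul_lintegral_kernel_pow_add_le [IsMarkovKernel κ] (hd : Measurable d) (hU : Measurable U)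
    (hdD : ∀ z, d z ≤ D) (hweak : ∀ z, ∫⁻ w, d w ∂κ z ≤ d z)
    (hcontr : ∀ z ∈ Δ, ∫⁻ w, d w ∂(κ ^ ℓ) z ≤ r * d z)
    (hdrift : ∀ z ∉ Δ, ∫⁻ w, U w ∂κ z + c ≤ U z)
    (hgrowth : ∀ z, ∫⁻ w, U w ∂κ z ≤ U z + β) (k n : ℕ) (z : α) :
    c * k * ∫⁻ w, d w ∂(κ ^ (ℓ + k + n)) z ≤
      c * k * (r * ∫⁻ w, d w ∂(κ ^ n) z) + D * (U z + n * β) := by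
  calc c * k * ∫⁻ w, d w ∂(κ ^ (ℓ + k + n)) z
      = ∫⁻ y, c * k * ∫⁻ w, d w ∂(κ ^ (ℓ + k)) y ∂(κ ^ n) z := by
        rw [lintegral_kernel_pow_add κ _ _ hd, lintegral_const_mul _ hd.lintegral_kernel]
    _ ≤ ∫⁻ y, (c * k * (r * d y) + D * U y) ∂(κ ^ n) z :=
        lintegral_mono fun y => mul_lintegral_kernel_pow_le hd hU hdD hweak hcontr hdrift k y
    _ = c * k * (r * ∫⁻ y, d y ∂(κ ^ n) z) + D * ∫⁻ y, U y ∂(κ ^ n) z := by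
        rw [lintegral_add_right _ (hU.const_mul D), lintegral_const_mul _ (hd.const_mul r),
          lintegral_const_mul _ hd, lintegral_const_mul _ hU]
    _ ≤ c * k * (r * ∫⁻ w, d w ∂(κ ^ n) z) + D * (U z + n * β) := by
        gcongr; exact lintegral_kernel_pow_le_of_drift hU hgrowth n z

lemma le_of_forall_natCast_mul_le_add {a b C : ℝ≥0∞} (hC : C ≠ ∞)
    (h : ∀ k : ℕ, k * a ≤ k * b + C) : a ≤ b := by
  by_contra! hlt
  obtain ⟨k, hk⟩ := ENNReal.exists_nat_mul_gt (tsub_pos_of_lt hlt).ne' hC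
  have hle : (k : ℝ≥0∞) * (a - b) ≤ C := by
    rw [ENNReal.mul_sub fun _ _ => ENNReal.natCast_ne_top k]
    exact tsub_le_iff_left.2 (h k)
  exact hk.not_ge hle

theorem tendsto_iSup_lintegral_kernel_pow [IsMarkovKernel κ] (hd : Measurable d)
    (hU : Measurable U) (hdD : ∀ z, d z ≤ D) (hD : D ≠ ∞) (hweak : ∀ z, ∫⁻ w, d w ∂κ z ≤ d z)
    (hr : r < 1) (hcontr : ∀ z ∈ Δ, ∫⁻ w, d w ∂(κ ^ ℓ) z ≤ r * d z)
    (hc : c ≠ 0) (hc_top : c ≠ ∞) (hdrift : ∀ z ∉ Δ, ∫⁻ w, U w ∂κ z + c ≤ U z)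
    (hβ : β ≠ ∞) (hgrowth : ∀ z, ∫⁻ w, U w ∂κ z ≤ U z + β) {R : ℝ≥0∞} (hR : R ≠ ∞) :
    Tendsto (fun n => ⨆ z ∈ {z | U z ≤ R}, ∫⁻ w, d w ∂(κ ^ n) z) atTop (𝓝 0) := by
  set e : ℕ → ℝ≥0∞ := fun n => ⨆ z ∈ {z | U z ≤ R}, ∫⁻ w, d w ∂(κ ^ n) z
  have he_anti : Antitone e := fun m n hmn =>
    iSup₂_mono fun z _ => antitone_lintegral_kernel_pow hd hweak z hmn
  have he_top : ⨅ n, e n ≠ ∞ := ne_top_of_le_ne_top hD <|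
    (iInf_le e 0).trans (iSup₂_le fun z _ => lintegral_le_const (.of_forall hdD))
  have hle (n k : ℕ) : c * k * e (ℓ + k + n) ≤ c * k * (r * e n) + D * (R + n * β) := by
    simp only [e, ENNReal.mul_iSup]
    refine iSup₂_le fun z (hz : U z ≤ R) => ?_
    refine (mul_lintegral_kernel_pow_add_le hd hU hdD hweak hcontr hdrift hgrowth k n z).trans ?_
    gcongr
    simp only [← ENNReal.mul_iSup]
    gcongr
    exact le_iSup₂ (f := fun z (_ : z ∈ {z | U z ≤ R}) => ∫⁻ w, d w ∂(κ ^ n) z) z hz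
  have hcontraction (n : ℕ) : ⨅ n, e n ≤ r * e n := by
    refine (ENNReal.mul_le_mul_iff_right hc hc_top).1 <|
      le_of_forall_natCast_mul_le_add (C := D * (R + n * β)) (by finiteness) fun k => ?_
    calc (k : ℝ≥0∞) * (c * ⨅ n, e n) = c * k * ⨅ n, e n := by ring
      _ ≤ c * k * e (ℓ + k + n) := by gcongr; exact iInf_le e _
      _ ≤ c * k * (r * e n) + D * (R + n * β) := hle n k
      _ = k * (c * (r * e n)) + D * (R + n * β) := by ring
  have he_le : ⨅ n, e n ≤ r * ⨅ n, e n := by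
    rw [ENNReal.mul_iInf fun hr_top => absurd hr_top hr.ne_top]
    exact le_iInf hcontraction
  have he_zero : ⨅ n, e n = 0 := by
    by_contra hne
    exact he_le.not_gt (by simpa using ENNReal.mul_lt_mul_left hne he_top hr)
  rw [← he_zero]
  exact tendsto_atTop_iInf he_anti

end Contraction

section Coupling

variable {α β α' β' : Type*} [MeasurableSpace α] [MeasurableSpace β] [MeasurableSpace α']
  [MeasurableSpace β']

/-- `γ` is a coupling of `μ` and `ν`: a measure on the product space with marginals `μ` and `ν`. -/
structure IsCoupling (γ : Measure (α × β)) (μ : Measure α) (ν : Measure β) : Prop where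
  measurePreserving_fst : MeasurePreserving Prod.fst γ μ
  measurePreserving_snd : MeasurePreserving Prod.snd γ ν

lemma isCoupling_prod (μ : Measure α) (ν : Measure β) [IsProbabilityMeasure μ]
    [IsProbabilityMeasure ν] : IsCoupling (μ.prod ν) μ ν :=
  ⟨measurePreserving_fst, measurePreserving_snd⟩

lemma isCoupling_dirac (x : α) (y : β) :
    IsCoupling (Measure.dirac (x, y)) (Measure.dirac x) (Measure.dirac y) :=
  ⟨⟨measurable_fst, Measure.map_dirac' measurable_fst _⟩,
    ⟨measurable_snd, Measure.map_dirac' measurable_snd _⟩⟩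

lemma measurePreserving_bind {γ : Measure α} {μ : Measure β} {K : Kernel α α'} {κ : Kernel β β'}
    {p : α → β} {q : α' → β'} (hp : MeasurePreserving p γ μ) (hq : Measurable q)
    (hK : ∀ z, (K z).map q = κ (p z)) : MeasurePreserving q (γ.bind K) (μ.bind κ) := by
  refine ⟨hq, ?_⟩
  have hcomp : K.map q = κ ∘ₖ Kernel.deterministic p hp.measurable := by
    ext1 z
    rw [Kernel.map_apply _ hq, hK, Kernel.comp_deterministic_eq_comap, Kernel.comap_apply]
  rw [Measure.map_comp _ _ hq, hcomp, ← Measure.comp_assoc, Measure.deterministic_comp_eq_map,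
    hp.map_eq]

namespace IsCoupling

variable {γ : Measure (α × β)} {μ : Measure α} {ν : Measure β}

lemma bind (h : IsCoupling γ μ ν) {K : Kernel (α × β) (α' × β')} {κ : Kernel α α'}
    {η : Kernel β β'} (hK : ∀ x y, IsCoupling (K (x, y)) (κ x) (η y)) :
    IsCoupling (γ.bind K) (μ.bind κ) (ν.bind η) where
  measurePreserving_fst := measurePreserving_bind h.measurePreserving_fst measurable_fst
    fun z => (hK z.1 z.2).measurePreserving_fst.map_eq
  measurePreserving_snd := measurePreserving_bind h.measurePreserving_snd measurable_snd
    fun z => (hK z.1 z.2).measurePreserving_snd.map_eq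

lemma lintegral_le_add (h : IsCoupling γ μ ν) {f : α → ℝ≥0∞} {g : β → ℝ≥0∞} {c : α × β → ℝ≥0∞}
    (hf : Measurable f) (hg : Measurable g) (hfg : ∀ x y, f x ≤ g y + c (x, y)) :
    ∫⁻ x, f x ∂μ ≤ ∫⁻ y, g y ∂ν + ∫⁻ z, c z ∂γ := by
  rw [← h.measurePreserving_fst.lintegral_comp hf, ← h.measurePreserving_snd.lintegral_comp hg,
    ← lintegral_add_left (f := fun z : α × β => g z.2) (hg.comp measurable_snd)]
  exact lintegral_mono fun z => hfg z.1 z.2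

lemma lintegral_add_eq (h : IsCoupling γ μ ν) {f : α → ℝ≥0∞} {g : β → ℝ≥0∞} (hf : Measurable f)
    (hg : Measurable g) : ∫⁻ z, (f z.1 + g z.2) ∂γ = ∫⁻ x, f x ∂μ + ∫⁻ y, g y ∂ν := by
  rw [← h.measurePreserving_fst.lintegral_comp hf, ← h.measurePreserving_snd.lintegral_comp hg]
  exact lintegral_add_left (hf.comp measurable_fst) _

lemma edist_integral_le [PseudoEMetricSpace α] {γ : Measure (α × α)} {μ ν : Measure α}
    (h : IsCoupling γ μ ν) {f : α → ℝ} {L : ℝ≥0} (hf : LipschitzWith L f)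
    (hfμ : Integrable f μ) (hfν : Integrable f ν) :
    edist (∫ x, f x ∂μ) (∫ y, f y ∂ν) ≤ L * ∫⁻ z, edist z.1 z.2 ∂γ := by
  have hint_fst : ∫ x, f x ∂μ = ∫ z, f z.1 ∂γ := by
    rw [← h.measurePreserving_fst.map_eq] at hfμ ⊢
    exact integral_map measurable_fst.aemeasurable hfμ.aestronglyMeasurable
  have hint_snd : ∫ y, f y ∂ν = ∫ z, f z.2 ∂γ := by
    rw [← h.measurePreserving_snd.map_eq] at hfν ⊢
    exact integral_map measurable_snd.aemeasurable hfν.aestronglyMeasurable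
  calc edist (∫ x, f x ∂μ) (∫ y, f y ∂ν) = ‖∫ z, (f z.1 - f z.2) ∂γ‖ₑ := by
        rw [hint_fst, hint_snd, edist_eq_enorm_sub]
        exact congrArg _ (integral_sub (h.measurePreserving_fst.integrable_comp_of_integrable hfμ)
          (h.measurePreserving_snd.integrable_comp_of_integrable hfν)).symm
    _ ≤ ∫⁻ z, ‖f z.1 - f z.2‖ₑ ∂γ := enorm_integral_le_lintegral_enorm _
    _ ≤ ∫⁻ z, L * edist z.1 z.2 ∂γ := by
        simp only [← edist_eq_enorm_sub]
        exact lintegral_mono fun z => hf.edist_le_mul z.1 z.2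
    _ = L * ∫⁻ z, edist z.1 z.2 ∂γ := lintegral_const_mul' _ _ ENNReal.coe_ne_top

end IsCoupling

theorem tendsto_of_isCoupling [PseudoEMetricSpace α] [OpensMeasurableSpace α] {ι : Type*}
    {l : Filter ι} [l.IsCountablyGenerated] {μs : ι → ProbabilityMeasure α}
    {μ : ProbabilityMeasure α} {γ : ι → Measure (α × α)} (hγ : ∀ i, IsCoupling (γ i) (μs i) μ)
    (hlim : Tendsto (fun i => ∫⁻ z, edist z.1 z.2 ∂γ i) l (𝓝 0)) : Tendsto μs l (𝓝 μ) := by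
  refine tendsto_iff_forall_lipschitz_integral_tendsto.2 fun f ⟨C, hC⟩ ⟨L, hL⟩ => ?_
  have hint (ν : ProbabilityMeasure α) : Integrable f (ν : Measure α) :=
    (BoundedContinuousFunction.mkOfBound ⟨f, hL.continuous⟩ C hC).integrable _
  refine tendsto_iff_edist_tendsto_0.2 (tendsto_of_tendsto_of_tendsto_of_le_of_le
    tendsto_const_nhds ?_ (fun _ => zero_le) fun i => (hγ i).edist_integral_le hL (hint _) (hint _))
  simpa using ENNReal.Tendsto.const_mul hlim (.inr ENNReal.coe_ne_top)

end Coupling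

section CouplingKernel

namespace IsCouplingKernel

variable {E : Type*} [MeasurableSpace E] {P : Kernel E E} {Q : Kernel (E × E) (E × E)}

lemma isCoupling (hQ : IsCouplingKernel P Q) (x y : E) : IsCoupling (Q (x, y)) (P x) (P y) :=
  ⟨⟨measurable_fst, hQ.map_fst x y⟩, ⟨measurable_snd, hQ.map_snd x y⟩⟩

lemma isCoupling_pow (hQ : IsCouplingKernel P Q) (n : ℕ) (x y : E) :
    IsCoupling ((Q ^ n) (x, y)) ((P ^ n) x) ((P ^ n) y) := by
  induction n with
  | zero => exact isCoupling_dirac x y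
  | succ n ih =>
    simp only [add_comm n 1, Kernel.pow_add, pow_one, Kernel.comp_apply]
    exact ih.bind hQ.isCoupling

variable [PseudoEMetricSpace E] [SecondCountableTopology E] [BorelSpace E] {D : ℝ≥0∞}

theorem eq_of_invariant (hQ : IsCouplingKernel P Q) (hD : D ≠ ∞)
    (hedist : ∀ x y : E, edist x y ≤ D)
    (hlim : ∀ z, Tendsto (fun n => ∫⁻ w, edist w.1 w.2 ∂(Q ^ n) z) atTop (𝓝 0))
    {π π' : ProbabilityMeasure E} (hπ : P.Invariant (π : Measure E))
    (hπ' : P.Invariant (π' : Measure E)) : π = π' := by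
  have := hQ.isMarkovKernel
  let γ (n : ℕ) : Measure (E × E) := ((π : Measure E).prod π').bind (Q ^ n)
  have hγ (n : ℕ) : IsCoupling (γ n) π π' := by
    have h := (isCoupling_prod (π : Measure E) π').bind (hQ.isCoupling_pow n)
    rwa [(invariant_pow hπ n).def, (invariant_pow hπ' n).def] at h
  have hlim_γ : Tendsto (fun n => ∫⁻ z, edist z.1 z.2 ∂γ n) atTop (𝓝 0) := by
    simp_rw [γ, Measure.lintegral_bind (Kernel.aemeasurable _) measurable_edist.aemeasurable]
    simpa using tendsto_lintegral_of_dominated_convergence (f := 0) (fun _ => D)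
      (fun n => measurable_edist.lintegral_kernel (κ := Q ^ n))
      (fun n => .of_forall fun z => lintegral_le_const (.of_forall fun w => hedist w.1 w.2))
      (by simpa using hD) (.of_forall hlim)
  exact tendsto_nhds_unique tendsto_const_nhds (tendsto_of_isCoupling hγ hlim_γ)

end IsCouplingKernel

end CouplingKernel

section Tightness

variable {E : Type*} [PseudoEMetricSpace E]

lemma isCompact_iInter_cthickening [CompleteSpace E] {ι : Type*} {l : Filter ι} [l.NeBot]
    {δ : ι → ℝ} (hδ : Tendsto δ l (𝓝 0)) {K : ι → Set E} (hK : ∀ i, TotallyBounded (K i)) :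
    IsCompact (⋂ i, Metric.cthickening (δ i) (K i)) := by
  refine TotallyBounded.isCompact_of_isClosed ?_
    (isClosed_iInter fun i => Metric.isClosed_cthickening)
  refine EMetric.totallyBounded_iff.2 fun r hr => ?_
  have hδ' : Tendsto (fun i => ENNReal.ofReal (δ i)) l (𝓝 0) := by
    simpa using ENNReal.tendsto_ofReal hδ
  obtain ⟨i, hi⟩ := (hδ'.eventually_lt_const (ENNReal.half_pos hr.ne')).exists
  obtain ⟨t, ht, hKt⟩ := EMetric.totallyBounded_iff.1 (hK i) (r / 2) (ENNReal.half_pos hr.ne')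
  refine ⟨t, ht, fun x hx => ?_⟩
  have hxK : Metric.infEDist x (K i) < r / 2 :=
    (Metric.mem_cthickening_iff.1 (Set.mem_iInter.1 hx i)).trans_lt hi
  obtain ⟨y, hy, hxy⟩ := Metric.infEDist_lt_iff.1 hxK
  obtain ⟨z, hz, hyz⟩ := Set.mem_iUnion₂.1 (hKt hy)
  refine Set.mem_iUnion₂.2 ⟨z, hz, ?_⟩
  calc edist x z ≤ edist x y + edist y z := edist_triangle x y z
    _ < r / 2 + r / 2 := ENNReal.add_lt_add hxy hyz
    _ = r := ENNReal.add_halves r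

lemma min_infEDist_one_le_add_edist (K : Set E) (x y : E) :
    min (Metric.infEDist x K) 1 ≤ min (Metric.infEDist y K) 1 + edist x y := by
  rw [← min_add_add_right]
  exact min_le_min Metric.infEDist_le_infEDist_add_edist le_self_add

variable [MeasurableSpace E]

lemma lintegral_min_infEDist_one_le (μ : Measure E) (K : Set E) :
    ∫⁻ x, min (Metric.infEDist x K) 1 ∂μ ≤ μ Kᶜ := by
  calc ∫⁻ x, min (Metric.infEDist x K) 1 ∂μ ≤ ∫⁻ x, Kᶜ.indicator 1 x ∂μ := by
        refine lintegral_mono fun x => ?_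
        by_cases hx : x ∈ K
        · simp [Metric.infEDist_zero_of_mem hx]
        · simp [hx]
    _ ≤ μ Kᶜ := lintegral_indicator_one_le _

lemma ofReal_mul_measure_compl_cthickening_le [OpensMeasurableSpace E] (μ : Measure E) (K : Set E)
    {δ : ℝ} (hδ : δ ≤ 1) :
    ENNReal.ofReal δ * μ (Metric.cthickening δ K)ᶜ ≤ ∫⁻ x, min (Metric.infEDist x K) 1 ∂μ := by
  have hsub : (Metric.cthickening δ K)ᶜ ⊆ {x | ENNReal.ofReal δ ≤ min (Metric.infEDist x K) 1} := by
    intro x hx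
    rw [Set.mem_compl_iff, Metric.mem_cthickening_iff, not_le] at hx
    exact le_min hx.le (ENNReal.ofReal_le_one.2 hδ)
  calc ENNReal.ofReal δ * μ (Metric.cthickening δ K)ᶜ
      ≤ ENNReal.ofReal δ * μ {x | ENNReal.ofReal δ ≤ min (Metric.infEDist x K) 1} := by gcongr
    _ ≤ ∫⁻ x, min (Metric.infEDist x K) 1 ∂μ :=
        mul_meas_ge_le_lintegral (by fun_prop) (ENNReal.ofReal δ)

variable [CompleteSpace E]

lemma isTightMeasureSet_of_forall_cthickening {S : Set (Measure E)}
    (h : ∀ δ : ℝ, 0 < δ → ∀ η : ℝ≥0∞, η ≠ 0 →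
      ∃ K : Set E, TotallyBounded K ∧ ∀ μ ∈ S, μ (Metric.cthickening δ K)ᶜ ≤ η) :
    IsTightMeasureSet S := by
  rw [isTightMeasureSet_iff_exists_isCompact_measure_compl_le]
  intro η hη
  obtain ⟨u, hu_pos, hu_sum⟩ := ENNReal.exists_pos_sum_of_countable' hη.ne' ℕ
  choose K hK hKS using fun n : ℕ => h (1 / (n + 1)) Nat.one_div_pos_of_nat (u n) (hu_pos n).ne'
  refine ⟨_, isCompact_iInter_cthickening tendsto_one_div_add_atTop_nhds_zero_nat hK,
    fun μ hμ => ?_⟩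
  rw [Set.compl_iInter]
  calc μ (⋃ n : ℕ, (Metric.cthickening (1 / (n + 1)) (K n))ᶜ)
      ≤ ∑' n : ℕ, μ (Metric.cthickening (1 / (n + 1)) (K n))ᶜ := measure_iUnion_le _
    _ ≤ ∑' n, u n := ENNReal.tsum_le_tsum fun n => hKS n μ hμ
    _ ≤ η := hu_sum.le

variable [SecondCountableTopology E] [BorelSpace E]

lemma exists_isCompact_measure_compl_le (μ : Measure E) [IsFiniteMeasure μ] {η : ℝ≥0∞}
    (hη : η ≠ 0) : ∃ K : Set E, IsCompact K ∧ μ Kᶜ ≤ η := by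
  simpa using isTightMeasureSet_iff_exists_isCompact_measure_compl_le.1
    (isTightMeasureSet_singleton (μ := μ)) η (pos_iff_ne_zero.2 hη)

lemma exists_isCompact_forall_lt_measure_compl_le (μ : ℕ → Measure E) [∀ n, IsFiniteMeasure (μ n)]
    (N : ℕ) {η : ℝ≥0∞} (hη : η ≠ 0) : ∃ K : Set E, IsCompact K ∧ ∀ n < N, μ n Kᶜ ≤ η := by
  choose K hK hKμ using fun n => exists_isCompact_measure_compl_le (μ n) hη
  refine ⟨⋃ n ∈ Finset.range N, K n, (Finset.range N).isCompact_biUnion fun n _ => hK n,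
    fun n hn => (measure_mono (Set.compl_subset_compl.2 ?_)).trans (hKμ n)⟩
  exact Set.subset_biUnion_of_mem (u := K) (Finset.mem_range.2 hn)

theorem isTightMeasureSet_range_of_eventually (μ : ℕ → Measure E) [∀ n, IsFiniteMeasure (μ n)]
    (h : ∀ η : ℝ≥0∞, η ≠ 0 → ∃ K : Set E, IsCompact K ∧
      ∀ᶠ n in atTop, ∫⁻ x, min (Metric.infEDist x K) 1 ∂μ n ≤ η) :
    IsTightMeasureSet (Set.range μ) := by
  refine isTightMeasureSet_of_forall_cthickening fun δ hδ η hη => ?_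
  have hmin_ne : ENNReal.ofReal (min δ 1) ≠ 0 := by simpa using hδ
  obtain ⟨K, hK, hKμ⟩ := h (ENNReal.ofReal (min δ 1) * η) (mul_ne_zero hmin_ne hη)
  obtain ⟨N, hN⟩ := eventually_atTop.1 hKμ
  obtain ⟨K', hK', hK'μ⟩ := exists_isCompact_forall_lt_measure_compl_le μ N hη
  refine ⟨K ∪ K', (hK.union hK').totallyBounded, ?_⟩
  rintro _ ⟨n, rfl⟩
  rcases lt_or_ge n N with hn | hn
  · have hsub : K' ⊆ Metric.cthickening δ (K ∪ K') :=
      Set.subset_union_right.trans (Metric.self_subset_cthickening _)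
    exact (measure_mono (Set.compl_subset_compl.2 hsub)).trans (hK'μ n hn)
  · have hsub : Metric.cthickening (min δ 1) K ⊆ Metric.cthickening δ (K ∪ K') :=
      (Metric.cthickening_mono (min_le_left _ _) _).trans
        (Metric.cthickening_subset_of_subset _ Set.subset_union_left)
    have hmarkov := (ofReal_mul_measure_compl_cthickening_le (μ n) K (min_le_right δ 1)).trans
      (hN n hn)
    exact (measure_mono (Set.compl_subset_compl.2 hsub)).trans
      ((ENNReal.mul_le_mul_iff_right hmin_ne ENNReal.ofReal_ne_top).1 hmarkov)

end Tightness

section Feller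

/-- A Markov kernel is Feller if its transition probabilities depend continuously on the starting
point for the topology of weak convergence. -/
def IsFeller {α β : Type*} [TopologicalSpace α] [MeasurableSpace α] [TopologicalSpace β]
    [MeasurableSpace β] [OpensMeasurableSpace β] (κ : Kernel α β) [IsMarkovKernel κ] : Prop :=
  Continuous (Y := ProbabilityMeasure β) fun x => ⟨κ x, inferInstance⟩

lemma IsFeller.exists_boundedContinuousFunction_eq_lintegral {α β : Type*} [TopologicalSpace α]
    [MeasurableSpace α] [TopologicalSpace β] [MeasurableSpace β] [OpensMeasurableSpace β]
    {κ : Kernel α β} [IsMarkovKernel κ] (hκ : IsFeller κ) (f : β →ᵇ ℝ≥0) :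
    ∃ g : α →ᵇ ℝ≥0, ∀ x, (g x : ℝ≥0∞) = ∫⁻ y, f y ∂κ x := by
  let κ' (x : α) : ProbabilityMeasure β := ⟨κ x, inferInstance⟩
  let g (x : α) : ℝ≥0 := (κ' x).toFiniteMeasure.testAgainstNN f
  have hg (x : α) : (g x : ℝ≥0∞) = ∫⁻ y, f y ∂κ x := FiniteMeasure.testAgainstNN_coe_eq
  have hg_cont : Continuous g := (ProbabilityMeasure.continuous_testAgainstNN_eval f).comp hκ
  have hg_le (x : α) : g x ≤ nndist f 0 := by
    rw [← ENNReal.coe_le_coe, hg]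
    exact lintegral_le_const
      (.of_forall fun y => mod_cast BoundedContinuousFunction.NNReal.upper_bound f y)
  refine ⟨.mkOfBound ⟨g, hg_cont⟩ (nndist f 0) fun x y => ?_, hg⟩
  rw [dist_nndist, ContinuousMap.coe_mk, NNReal.nndist_eq, NNReal.coe_le_coe]
  exact max_le (tsub_le_self.trans (hg_le x)) (tsub_le_self.trans (hg_le y))

theorem IsCouplingKernel.isFeller {E : Type*} [PseudoEMetricSpace E] [MeasurableSpace E]
    [OpensMeasurableSpace E] {P : Kernel E E} [IsMarkovKernel P] {Q : Kernel (E × E) (E × E)}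
    (hQ : IsCouplingKernel P Q)
    (hQ_lim : ∀ y, Tendsto (fun x => ∫⁻ z, edist z.1 z.2 ∂Q (x, y)) (𝓝 y) (𝓝 0)) :
    IsFeller P :=
  continuous_iff_continuousAt.2 fun y =>
    tendsto_of_isCoupling (fun x => hQ.isCoupling x y) (hQ_lim y)

end Feller

section Cesaro

lemma sum_range_le_add_sum_range_add {g : ℕ → ℝ≥0∞} {C : ℝ≥0∞} (hg : ∀ k, g k ≤ C) (m n : ℕ) :
    ∑ k ∈ Finset.range m, g k ≤ n * C + ∑ k ∈ Finset.range m, g (n + k) := by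
  calc ∑ k ∈ Finset.range m, g k ≤ ∑ k ∈ Finset.range (n + m), g k :=
        Finset.sum_le_sum_of_subset (Finset.range_subset_range.2 (Nat.le_add_left m n))
    _ = ∑ k ∈ Finset.range n, g k + ∑ k ∈ Finset.range m, g (n + k) := Finset.sum_range_add _ _ _
    _ ≤ n * C + ∑ k ∈ Finset.range m, g (n + k) := by
        gcongr; simpa using Finset.sum_le_card_nsmul (Finset.range n) g C fun k _ => hg k

lemma sum_range_add_le_sum_range_add {g : ℕ → ℝ≥0∞} {C : ℝ≥0∞} (hg : ∀ k, g k ≤ C) (m n : ℕ) :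
    ∑ k ∈ Finset.range m, g (n + k) ≤ ∑ k ∈ Finset.range m, g k + n * C := by
  calc ∑ k ∈ Finset.range m, g (n + k)
      ≤ ∑ k ∈ Finset.range n, g k + ∑ k ∈ Finset.range m, g (n + k) := le_add_self
    _ = ∑ k ∈ Finset.range m, g k + ∑ k ∈ Finset.range n, g (m + k) := by
        rw [← Finset.sum_range_add, ← Finset.sum_range_add, add_comm n m]
    _ ≤ ∑ k ∈ Finset.range m, g k + n * C := by
        gcongr
        simpa using Finset.sum_le_card_nsmul (Finset.range n) (fun k => g (m + k)) C fun k _ => hg _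

lemma tendsto_inv_natCast_add_one_mul {c : ℝ≥0∞} (hc : c ≠ ∞) :
    Tendsto (fun m : ℕ => (m + 1 : ℝ≥0∞)⁻¹ * c) atTop (𝓝 0) := by
  simpa using ENNReal.Tendsto.mul_const
    ((tendsto_add_atTop_iff_nat 1).2 ENNReal.tendsto_inv_nat_nhds_zero) (.inr hc)

variable {E : Type*} [MeasurableSpace E]

/-- The law of the chain with kernel `P` started from `x`, averaged over the times `0, …, m`. -/
noncomputable def cesaroMeasure (P : Kernel E E) (x : E) (m : ℕ) : Measure E :=
  (m + 1 : ℝ≥0∞)⁻¹ • ∑ k ∈ Finset.range (m + 1), (P ^ k) x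

lemma lintegral_cesaroMeasure (P : Kernel E E) (x : E) (m : ℕ) (f : E → ℝ≥0∞) :
    ∫⁻ y, f y ∂cesaroMeasure P x m =
      (m + 1 : ℝ≥0∞)⁻¹ * ∑ k ∈ Finset.range (m + 1), ∫⁻ y, f y ∂(P ^ k) x := by
  rw [cesaroMeasure, lintegral_smul_measure, lintegral_finsetSum_measure, smul_eq_mul]

lemma inv_natCast_add_one_mul_cancel_left (m : ℕ) (a : ℝ≥0∞) :
    (m + 1 : ℝ≥0∞)⁻¹ * ((m + 1) * a) = a := by
  rw [← mul_assoc, ENNReal.inv_mul_cancel (by simp) (by finiteness), one_mul]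

lemma lintegral_lintegral_cesaroMeasure_of_invariant {P : Kernel E E} {π : Measure E}
    (hπ : P.Invariant π) (m : ℕ) {f : E → ℝ≥0∞} (hf : Measurable f) :
    ∫⁻ x, ∫⁻ y, f y ∂cesaroMeasure P x m ∂π = ∫⁻ x, f x ∂π := by
  have hsum : ∑ k ∈ Finset.range (m + 1), ∫⁻ x, ∫⁻ y, f y ∂(P ^ k) x ∂π =
      (m + 1) * ∫⁻ x, f x ∂π := by
    simp [fun k => lintegral_lintegral_of_invariant (invariant_pow hπ k) hf]
  simp_rw [lintegral_cesaroMeasure]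
  rw [lintegral_const_mul _ (Finset.measurable_sum _ fun k _ => hf.lintegral_kernel),
    lintegral_finsetSum _ fun k _ => hf.lintegral_kernel, hsum,
    inv_natCast_add_one_mul_cancel_left]

variable {P : Kernel E E} [IsMarkovKernel P]

instance isProbabilityMeasure_cesaroMeasure (x : E) (m : ℕ) :
    IsProbabilityMeasure (cesaroMeasure P x m) where
  measure_univ := by
    rw [← lintegral_one, lintegral_cesaroMeasure]
    simpa using inv_natCast_add_one_mul_cancel_left m 1

lemma lintegral_cesaroMeasure_le_add (x : E) (m n : ℕ) {f : E → ℝ≥0∞} (hf : Measurable f)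
    {C : ℝ≥0∞} (hfC : ∀ y, f y ≤ C) :
    ∫⁻ y, f y ∂cesaroMeasure P x m ≤
      (m + 1 : ℝ≥0∞)⁻¹ * (n * C) + ∫⁻ y, ∫⁻ z, f z ∂(P ^ n) y ∂cesaroMeasure P x m := by
  simp_rw [lintegral_cesaroMeasure, ← mul_add, ← lintegral_kernel_pow_add P n _ hf]
  gcongr
  exact sum_range_le_add_sum_range_add (fun k => lintegral_le_const (.of_forall hfC)) _ _

lemma lintegral_lintegral_cesaroMeasure_le_add (x : E) (m n : ℕ) {f : E → ℝ≥0∞}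
    (hf : Measurable f) {C : ℝ≥0∞} (hfC : ∀ y, f y ≤ C) :
    ∫⁻ y, ∫⁻ z, f z ∂(P ^ n) y ∂cesaroMeasure P x m ≤
      ∫⁻ y, f y ∂cesaroMeasure P x m + (m + 1 : ℝ≥0∞)⁻¹ * (n * C) := by
  simp_rw [lintegral_cesaroMeasure, ← mul_add, ← lintegral_kernel_pow_add P n _ hf]
  gcongr
  exact sum_range_add_le_sum_range_add (fun k => lintegral_le_const (.of_forall hfC)) _ _

lemma lintegral_cesaroMeasure_le_of_drift {W ψ : E → ℝ≥0∞} (hψ : Measurable ψ) {β : ℝ≥0∞}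
    (hdrift : ∀ x, ∫⁻ y, W y ∂P x + ψ x ≤ W x + β) (x : E) (m : ℕ) :
    ∫⁻ y, ψ y ∂cesaroMeasure P x m ≤ (m + 1 : ℝ≥0∞)⁻¹ * W x + β := by
  calc ∫⁻ y, ψ y ∂cesaroMeasure P x m
      ≤ (m + 1 : ℝ≥0∞)⁻¹ * (W x + (m + 1) * β) := by
        rw [lintegral_cesaroMeasure]
        gcongr
        exact_mod_cast sum_lintegral_kernel_pow_le_of_drift hψ hdrift (m + 1) x
    _ = (m + 1 : ℝ≥0∞)⁻¹ * W x + β := by rw [mul_add, inv_natCast_add_one_mul_cancel_left]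

lemma lintegral_min_le_of_invariant_of_drift {π : Measure E} [IsProbabilityMeasure π]
    (hπ : P.Invariant π) {W ψ : E → ℝ≥0∞} (hW : Measurable W) (hW_top : ∀ x, W x ≠ ∞)
    (hψ : Measurable ψ) {β : ℝ≥0∞} (hdrift : ∀ x, ∫⁻ y, W y ∂P x + ψ x ≤ W x + β) (M : ℝ≥0) :
    ∫⁻ x, min (ψ x) M ∂π ≤ β := by
  have hle (m : ℕ) :
      ∫⁻ x, min (ψ x) M ∂π ≤ ∫⁻ x, min ((m + 1 : ℝ≥0∞)⁻¹ * W x + β) M ∂π := by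
    rw [← lintegral_lintegral_cesaroMeasure_of_invariant hπ m (hψ.min measurable_const)]
    refine lintegral_mono fun x =>
      le_min ?_ (lintegral_le_const (.of_forall fun y => min_le_right _ _))
    exact (lintegral_mono fun y => min_le_left _ _).trans
      (lintegral_cesaroMeasure_le_of_drift hψ hdrift x m)
  have hlim : Tendsto (fun m : ℕ => ∫⁻ x, min ((m + 1 : ℝ≥0∞)⁻¹ * W x + β) M ∂π) atTop
      (𝓝 (∫⁻ _, min β M ∂π)) := by
    refine tendsto_lintegral_of_dominated_convergence (fun _ => (M : ℝ≥0∞)) (fun m => by fun_prop)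
      (fun m => .of_forall fun x => min_le_right _ _) (by simp) (.of_forall fun x => ?_)
    simpa using ((tendsto_inv_natCast_add_one_mul (hW_top x)).add_const β).min tendsto_const_nhds
  calc ∫⁻ x, min (ψ x) M ∂π ≤ ∫⁻ _, min β M ∂π := ge_of_tendsto' hlim hle
    _ ≤ β := by simp

/- The function `W` may have infinite `π`-integral, so the drift inequality is not integrated
against `π` but along the chain started from each point, where the initial cost `W x` averages
out. -/
theorem lintegral_le_of_invariant_of_drift {π : Measure E} [IsProbabilityMeasure π]
    (hπ : P.Invariant π) {W ψ : E → ℝ≥0∞} (hW : Measurable W) (hW_top : ∀ x, W x ≠ ∞)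
    (hψ : Measurable ψ) {β : ℝ≥0∞} (hdrift : ∀ x, ∫⁻ y, W y ∂P x + ψ x ≤ W x + β) :
    ∫⁻ x, ψ x ∂π ≤ β := by
  have hsup (x : E) : ψ x = ⨆ M : ℕ, min (ψ x) (M : ℝ≥0) := by
    simpa [ENNReal.iSup_natCast] using inf_iSup_eq (ψ x) fun M : ℕ => (M : ℝ≥0∞)
  calc ∫⁻ x, ψ x ∂π = ⨆ M : ℕ, ∫⁻ x, min (ψ x) (M : ℝ≥0) ∂π := by
        rw [lintegral_congr hsup]
        exact lintegral_iSup (fun M => hψ.min measurable_const)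
          fun M N hMN x => min_le_min_left _ (by gcongr)
    _ ≤ β := iSup_le fun M =>
        lintegral_min_le_of_invariant_of_drift hπ hW hW_top hψ hdrift M

end Cesaro

section Existence

variable {E : Type*} [MeasurableSpace E] [TopologicalSpace E] {P : Kernel E E} [IsMarkovKernel P]

theorem IsFeller.invariant_of_tendsto_cesaroMeasure [HasOuterApproxClosed E] [BorelSpace E]
    (hP : IsFeller P) {x : E} {l : Filter ℕ} [l.NeBot] (hl : l ≤ atTop)
    {π : ProbabilityMeasure E}
    (hπ : Tendsto (β := ProbabilityMeasure E) (fun m => ⟨cesaroMeasure P x m, inferInstance⟩) l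
      (𝓝 π)) : P.Invariant (π : Measure E) := by
  refine ext_of_forall_lintegral_eq_of_IsFiniteMeasure fun f => ?_
  obtain ⟨g, hg⟩ := hP.exists_boundedContinuousFunction_eq_lintegral f
  have hf : Measurable fun y => (f y : ℝ≥0∞) := f.continuous.measurable.coe_nnreal_ennreal
  have hfC (y : E) : (f y : ℝ≥0∞) ≤ nndist f 0 :=
    mod_cast BoundedContinuousFunction.NNReal.upper_bound f y
  have hlim_f := ProbabilityMeasure.tendsto_iff_forall_lintegral_tendsto.1 hπ f
  have hlim_g := ProbabilityMeasure.tendsto_iff_forall_lintegral_tendsto.1 hπ g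
  have hlim_error : Tendsto (fun m : ℕ => (m + 1 : ℝ≥0∞)⁻¹ * ((1 : ℕ) * nndist f 0)) l (𝓝 0) :=
    (tendsto_inv_natCast_add_one_mul (by finiteness)).mono_left hl
  have hg' (m : ℕ) : ∫⁻ y, g y ∂cesaroMeasure P x m =
      ∫⁻ y, ∫⁻ z, f z ∂(P ^ 1) y ∂cesaroMeasure P x m := by simp_rw [hg, pow_one]
  rw [Measure.lintegral_bind P.aemeasurable hf.aemeasurable]
  simp_rw [← hg]
  apply le_antisymm
  · refine le_of_tendsto_of_tendsto' hlim_g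
      (by simpa only [add_zero] using hlim_f.add hlim_error) fun m => ?_
    exact (hg' m).trans_le (lintegral_lintegral_cesaroMeasure_le_add x m 1 hf hfC)
  · refine le_of_tendsto_of_tendsto' hlim_f
      (by simpa only [zero_add] using hlim_error.add hlim_g) fun m => ?_
    exact (lintegral_cesaroMeasure_le_add x m 1 hf hfC).trans_eq (by rw [← hg' m]; rfl)

theorem IsFeller.exists_invariant [T2Space E] [HasOuterApproxClosed E] [BorelSpace E]
    (hP : IsFeller P) {x : E} (htight : IsTightMeasureSet (Set.range (cesaroMeasure P x))) :
    ∃ π : ProbabilityMeasure E, P.Invariant (π : Measure E) := by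
  let μ (m : ℕ) : ProbabilityMeasure E := ⟨cesaroMeasure P x m, inferInstance⟩
  have hcompact : IsCompact (closure (Set.range μ)) := by
    refine isCompact_closure_of_isTightMeasureSet (htight.subset ?_)
    rintro _ ⟨_, ⟨m, rfl⟩, rfl⟩
    exact ⟨m, rfl⟩
  obtain ⟨π, -, hπ⟩ := hcompact.ultrafilter_le_nhds ((Ultrafilter.of atTop).map μ)
    (tendsto_principal.2 (.of_forall fun m => subset_closure ⟨m, rfl⟩))
  exact ⟨π, hP.invariant_of_tendsto_cesaroMeasure (Ultrafilter.of_le atTop) hπ⟩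

end Existence

section CesaroTightness

variable {E : Type*} [PseudoEMetricSpace E] [CompleteSpace E] [SecondCountableTopology E]
  [MeasurableSpace E] [BorelSpace E] {P : Kernel E E} [IsMarkovKernel P]

theorem IsCouplingKernel.isTightMeasureSet_range_cesaroMeasure {Q : Kernel (E × E) (E × E)}
    (hQ : IsCouplingKernel P Q) {x : E} {ψ : E → ℝ≥0∞} (hψ : Measurable ψ) {C : ℝ≥0∞} (hC : C ≠ ∞)
    (hψC : ∀ m, ∫⁻ y, ψ y ∂cesaroMeasure P x m ≤ C)
    (hQ_le : ∀ a : ℝ≥0∞, a ≠ 0 →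
      ∃ n : ℕ, ∀ y, ∫⁻ z, edist z.1 z.2 ∂(Q ^ n) (y, x) ≤ a + a * ψ y) :
    IsTightMeasureSet (Set.range (cesaroMeasure P x)) := by
  refine isTightMeasureSet_range_of_eventually _ fun η hη => ?_
  set a := η / (3 + C)
  have ha : a ≠ 0 := ENNReal.div_ne_zero.2 ⟨hη, by finiteness⟩
  obtain ⟨n, hn⟩ := hQ_le a ha
  obtain ⟨K, hK, hKx⟩ := exists_isCompact_measure_compl_le ((P ^ n) x) ha
  refine ⟨K, hK, ?_⟩
  set f : E → ℝ≥0∞ := fun y => min (Metric.infEDist y K) 1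
  have hf : Measurable f := by fun_prop
  have hf_le (y : E) : f y ≤ 1 := min_le_right _ _
  have hfn (y : E) : ∫⁻ z, f z ∂(P ^ n) y ≤ 2 * a + a * ψ y := by
    calc ∫⁻ z, f z ∂(P ^ n) y
        ≤ ∫⁻ z, f z ∂(P ^ n) x + ∫⁻ z, edist z.1 z.2 ∂(Q ^ n) (y, x) :=
          (hQ.isCoupling_pow n y x).lintegral_le_add hf hf (min_infEDist_one_le_add_edist K)
      _ ≤ a + (a + a * ψ y) :=
          add_le_add ((lintegral_min_infEDist_one_le _ K).trans hKx) (hn y)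
      _ = 2 * a + a * ψ y := by ring
  have hlim := tendsto_inv_natCast_add_one_mul (c := n * 1) (by finiteness)
  filter_upwards [hlim.eventually_le_const (pos_iff_ne_zero.2 ha)] with m hm
  calc ∫⁻ y, f y ∂cesaroMeasure P x m
      ≤ a + ∫⁻ y, (2 * a + a * ψ y) ∂cesaroMeasure P x m :=
        (lintegral_cesaroMeasure_le_add x m n hf hf_le).trans (add_le_add hm (lintegral_mono hfn))
    _ = a + (2 * a + a * ∫⁻ y, ψ y ∂cesaroMeasure P x m) := by
        rw [lintegral_add_left measurable_const, lintegral_const_mul _ hψ]; simp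
    _ ≤ a + (2 * a + a * C) := by gcongr; exact hψC m
    _ = (3 + C) * a := by ring
    _ ≤ η := ENNReal.mul_div_le

end CesaroTightness

section DoubleDrift

lemma exists_forall_le_add_mul {α : Type*} {W ψ : α → ℝ≥0∞}
    (hψ : Tendsto ψ (comap W (𝓝 ∞)) (𝓝 ∞)) {f : ℕ → α → ℝ≥0∞} {D : ℝ≥0∞} (hD : D ≠ ∞)
    (hfD : ∀ n y, f n y ≤ D)
    (hf : ∀ R : ℝ≥0∞, R ≠ ∞ → Tendsto (fun n => ⨆ y ∈ {y | W y ≤ R}, f n y) atTop (𝓝 0))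
    {a : ℝ≥0∞} (ha : a ≠ 0) : ∃ n, ∀ y, f n y ≤ a + a * ψ y := by
  obtain ⟨N, hN⟩ := ENNReal.exists_nat_mul_gt ha hD
  have hψN : ∀ᶠ y in comap W (𝓝 ∞), (N : ℝ≥0∞) ≤ ψ y :=
    hψ.eventually_const_le (ENNReal.natCast_lt_top N)
  obtain ⟨R, hR, hRψ⟩ := (ENNReal.nhds_top_basis.comap W).eventually_iff.1 hψN
  obtain ⟨n, hn⟩ := ((hf R hR.ne).eventually_le_const (pos_iff_ne_zero.2 ha)).exists
  refine ⟨n, fun y => ?_⟩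
  rcases le_or_gt (W y) R with hy | hy
  · exact (iSup₂_le_iff.1 hn y hy).trans le_self_add
  · calc f n y ≤ D := hfD n y
      _ ≤ a * N := by rw [mul_comm]; exact hN.le
      _ ≤ a * ψ y := by gcongr; exact hRψ hy
      _ ≤ a + a * ψ y := le_add_self

namespace IsCouplingKernel

variable {E : Type*} [MeasurableSpace E] {P : Kernel E E} {Q : Kernel (E × E) (E × E)}
  {Δ : Set (E × E)} {ℓ : ℕ} {D r c β : ℝ≥0∞} {W ψ : E → ℝ≥0∞}

theorem tendsto_iSup_lintegral_edist [PseudoEMetricSpace E] [SecondCountableTopology E]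
    [BorelSpace E] (hQ : IsCouplingKernel P Q) (hD : D ≠ ∞) (hedist : ∀ x y : E, edist x y ≤ D)
    (hweak : ∀ z, ∫⁻ w, edist w.1 w.2 ∂Q z ≤ edist z.1 z.2) (hr : r < 1)
    (hcontr : ∀ z ∈ Δ, ∫⁻ w, edist w.1 w.2 ∂(Q ^ ℓ) z ≤ r * edist z.1 z.2)
    (hW : Measurable W) (hc : c ≠ 0) (hc_top : c ≠ ∞)
    (hpair : ∀ x y, (x, y) ∉ Δ → ∫⁻ u, W u ∂P x + ∫⁻ u, W u ∂P y + c ≤ W x + W y)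
    (hβ : β ≠ ∞) (hgrowth : ∀ x, ∫⁻ y, W y ∂P x ≤ W x + β) {R : ℝ≥0∞} (hR : R ≠ ∞) :
    Tendsto (fun n => ⨆ z ∈ {z : E × E | W z.1 + W z.2 ≤ R}, ∫⁻ w, edist w.1 w.2 ∂(Q ^ n) z)
      atTop (𝓝 0) := by
  have := hQ.isMarkovKernel
  have hint (z : E × E) :
      ∫⁻ w, (W w.1 + W w.2) ∂Q z = ∫⁻ u, W u ∂P z.1 + ∫⁻ u, W u ∂P z.2 :=
    (hQ.isCoupling z.1 z.2).lintegral_add_eq hW hW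
  refine tendsto_iSup_lintegral_kernel_pow (d := fun z : E × E => edist z.1 z.2)
    (U := fun z => W z.1 + W z.2) (β := β + β) measurable_edist (by fun_prop)
    (fun z => hedist z.1 z.2) hD hweak hr hcontr hc hc_top (fun z hz => ?_) (by finiteness)
    (fun z => ?_) hR
  · rw [hint]
    exact hpair z.1 z.2 hz
  · rw [hint, add_add_add_comm]
    exact add_le_add (hgrowth z.1) (hgrowth z.2)

theorem existsUnique_invariant [EMetricSpace E] [CompleteSpace E] [SecondCountableTopology E]
    [BorelSpace E] [Nonempty E] [IsMarkovKernel P] (hQ : IsCouplingKernel P Q) (hD : D ≠ ∞)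
    (hedist : ∀ x y : E, edist x y ≤ D)
    (hweak : ∀ z, ∫⁻ w, edist w.1 w.2 ∂Q z ≤ edist z.1 z.2) (hr : r < 1)
    (hcontr : ∀ z ∈ Δ, ∫⁻ w, edist w.1 w.2 ∂(Q ^ ℓ) z ≤ r * edist z.1 z.2)
    (hW : Measurable W) (hW_top : ∀ x, W x ≠ ∞) (hc : c ≠ 0) (hc_top : c ≠ ∞)
    (hpair : ∀ x y, (x, y) ∉ Δ → ∫⁻ u, W u ∂P x + ∫⁻ u, W u ∂P y + c ≤ W x + W y)
    (hψ : Measurable ψ) (hψ_lim : Tendsto ψ (comap W (𝓝 ∞)) (𝓝 ∞)) (hβ : β ≠ ∞)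
    (hdrift : ∀ x, ∫⁻ y, W y ∂P x + ψ x ≤ W x + β) :
    ∃! π : ProbabilityMeasure E, P.Invariant (π : Measure E) := by
  have := hQ.isMarkovKernel
  obtain ⟨x⟩ := ‹Nonempty E›
  have hsup (R : ℝ≥0∞) (hR : R ≠ ∞) : Tendsto
      (fun n => ⨆ z ∈ {z : E × E | W z.1 + W z.2 ≤ R}, ∫⁻ w, edist w.1 w.2 ∂(Q ^ n) z)
      atTop (𝓝 0) :=
    hQ.tendsto_iSup_lintegral_edist hD hedist hweak hr hcontr hW hc hc_top hpair hβ
      (fun x => le_self_add.trans (hdrift x)) hR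
  have hlim (z : E × E) : Tendsto (fun n => ∫⁻ w, edist w.1 w.2 ∂(Q ^ n) z) atTop (𝓝 0) :=
    tendsto_of_tendsto_of_tendsto_of_le_of_le tendsto_const_nhds
      (hsup _ (ENNReal.add_ne_top.2 ⟨hW_top z.1, hW_top z.2⟩)) (fun _ => zero_le)
      fun n => le_iSup₂_of_le z (le_refl (W z.1 + W z.2)) le_rfl
  have hfeller : IsFeller P := hQ.isFeller fun y =>
    tendsto_of_tendsto_of_tendsto_of_le_of_le tendsto_const_nhds
      (tendsto_iff_edist_tendsto_0.1 tendsto_id) (fun _ => zero_le) fun x => hweak (x, y)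
  have htight : IsTightMeasureSet (Set.range (cesaroMeasure P x)) := by
    refine hQ.isTightMeasureSet_range_cesaroMeasure hψ (C := W x + β) (by finiteness [hW_top x])
      (fun m => ?_) fun a ha => exists_forall_le_add_mul hψ_lim hD (fun n y => ?_)
        (fun R hR => ?_) ha
    · refine (lintegral_cesaroMeasure_le_of_drift hψ hdrift x m).trans ?_
      gcongr
      exact mul_le_of_le_one_left' (ENNReal.inv_le_one.2 le_add_self)
    · exact lintegral_le_const (.of_forall fun w => hedist w.1 w.2)
    · refine tendsto_of_tendsto_of_tendsto_of_le_of_le tendsto_const_nhds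
        (hsup (R + W x) (by finiteness [hW_top x])) (fun _ => zero_le) fun n => ?_
      exact iSup₂_le fun y hy => le_iSup₂_of_le (y, x) (add_le_add_left hy (W x)) le_rfl
  obtain ⟨π, hπ⟩ := hfeller.exists_invariant htight
  exact ⟨π, hπ, fun π' hπ' => hQ.eq_of_invariant hD hedist hlim hπ' hπ⟩

end IsCouplingKernel

end DoubleDrift

section RealValued

lemma lintegral_edist_eq_ofReal_integral_dist {E : Type*} [PseudoMetricSpace E]
    [SecondCountableTopology E] [MeasurableSpace E] [OpensMeasurableSpace E] {D : ℝ}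
    (hd : ∀ x y : E, dist x y ≤ D) (μ : Measure (E × E)) [IsFiniteMeasure μ] :
    ∫⁻ z, edist z.1 z.2 ∂μ = ENNReal.ofReal (∫ z, dist z.1 z.2 ∂μ) := by
  have hint : Integrable (fun z : E × E => dist z.1 z.2) μ :=
    .of_bound measurable_dist.aestronglyMeasurable D (.of_forall fun z => by simpa using hd z.1 z.2)
  rw [ofReal_integral_eq_lintegral_ofReal hint (.of_forall fun z => dist_nonneg)]
  simp_rw [edist_dist]

lemma lintegral_edist_le_ofReal_mul_edist {E : Type*} [PseudoMetricSpace E]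
    [SecondCountableTopology E] [MeasurableSpace E] [OpensMeasurableSpace E] {D : ℝ}
    (hd : ∀ x y : E, dist x y ≤ D) {μ : Measure (E × E)} [IsFiniteMeasure μ] {r : ℝ} {x y : E}
    (h : ∫ z, dist z.1 z.2 ∂μ ≤ r * dist x y) :
    ∫⁻ z, edist z.1 z.2 ∂μ ≤ ENNReal.ofReal r * edist x y := by
  rw [lintegral_edist_eq_ofReal_integral_dist hd, edist_dist, ← ENNReal.ofReal_mul' dist_nonneg]
  exact ENNReal.ofReal_le_ofReal h

lemma measurable_comp_of_monotoneOn_Ici {E : Type*} [MeasurableSpace E] {φ : ℝ → ℝ} {a : ℝ}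
    (hφ : MonotoneOn φ (Set.Ici a)) {V : E → ℝ} (hV : Measurable V) (hVa : ∀ x, a ≤ V x) :
    Measurable fun x => φ (V x) := by
  have hmono : Monotone fun t => φ (max a t) := fun s t hst =>
    hφ (le_max_left a s) (le_max_left a t) (max_le_max_left a hst)
  simpa only [Function.comp_def, max_eq_right (hVa _)] using hmono.measurable.comp hV

lemma add_ofReal_le_of_le_ofReal_sub {I : ℝ≥0∞} (hI : I ≠ 0) {s t : ℝ} (ht : 0 ≤ t)
    (h : I ≤ ENNReal.ofReal (s - t)) : I + ENNReal.ofReal t ≤ ENNReal.ofReal s := by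
  have hst : 0 ≤ s - t := by
    by_contra! hneg
    exact hI (nonpos_iff_eq_zero.1 (h.trans_eq (ENNReal.ofReal_of_nonpos hneg.le)))
  calc I + ENNReal.ofReal t ≤ ENNReal.ofReal (s - t) + ENNReal.ofReal t := by gcongr
    _ = ENNReal.ofReal s := by rw [← ENNReal.ofReal_add hst ht, sub_add_cancel]

lemma IsConcaveRate.pos {φ : ℝ → ℝ} (h : IsConcaveRate φ) {t : ℝ} (ht : 0 < t) : 0 < φ t := by
  obtain ⟨s, hst, hs⟩ := ((eventually_gt_atTop t).and
    (h.tendsto_atTop.eventually_gt_atTop 0)).exists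
  have hs_pos : 0 < s := ht.trans hst
  have hts : t / s ≤ 1 := (div_le_one hs_pos).2 hst.le
  calc 0 < (1 - t / s) * φ 0 + t / s * φ s :=
        add_pos_of_nonneg_of_pos (mul_nonneg (sub_nonneg.2 hts) (h.nonneg 0 le_rfl)) (by positivity)
    _ ≤ φ ((1 - t / s) * 0 + t / s * s) :=
        h.concaveOn.2 (Set.mem_Ici.2 le_rfl) (Set.mem_Ici.2 hs_pos.le) (sub_nonneg.2 hts)
          (by positivity) (sub_add_cancel 1 _)
    _ = φ t := by rw [mul_zero, zero_add, div_mul_cancel₀ t hs_pos.ne']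

lemma tendsto_ofReal_comp_comap_nhds_top {E : Type*} {φ : ℝ → ℝ} (hφ : Tendsto φ atTop atTop)
    (V : E → ℝ) :
    Tendsto (fun x => ENNReal.ofReal (φ (V x)))
      (comap (fun x => 2 * ENNReal.ofReal (V x)) (𝓝 ∞)) (𝓝 ∞) := by
  have htwo (x : E) : 2 * ENNReal.ofReal (V x) = ENNReal.ofReal (2 * V x) := by
    rw [ENNReal.ofReal_mul zero_le_two, ENNReal.ofReal_ofNat]
  refine ENNReal.tendsto_ofReal_nhds_top.2 (hφ.comp ?_)
  refine (tendsto_const_mul_atTop_of_pos zero_lt_two).1 (ENNReal.tendsto_ofReal_nhds_top.1 ?_)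
  simpa only [htwo] using tendsto_comap (f := fun x => 2 * ENNReal.ofReal (V x)) (x := 𝓝 ∞)

variable {E : Type*} [MeasurableSpace E] {P : Kernel E E} [IsMarkovKernel P] {φ : ℝ → ℝ}
  {V : E → ℝ} {b : ℝ}

lemma lintegral_add_lintegral_add_ofReal_le {μ ν : Measure E} [IsProbabilityMeasure μ]
    (hV : ∀ x, 1 ≤ V x) {s t : ℝ} (ht : 0 ≤ t)
    (h : ∫⁻ u, ENNReal.ofReal (V u) ∂μ + ∫⁻ u, ENNReal.ofReal (V u) ∂ν ≤ ENNReal.ofReal (s - t)) :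
    ∫⁻ u, ENNReal.ofReal (V u) ∂μ + ∫⁻ u, ENNReal.ofReal (V u) ∂ν + ENNReal.ofReal t ≤
      ENNReal.ofReal s := by
  have hone : 1 ≤ ∫⁻ u, ENNReal.ofReal (V u) ∂μ := by
    simpa using lintegral_mono (μ := μ) fun u => ENNReal.one_le_ofReal.2 (hV u)
  exact add_ofReal_le_of_le_ofReal_sub (one_pos.trans_le (hone.trans le_self_add)).ne' ht h

lemma lintegral_two_mul_add_le_of_drift (hφ_mono : MonotoneOn φ (Set.Ici 0)) (hφ : 0 ≤ φ 2)
    (hV : Measurable V) (hV_one : ∀ x, 1 ≤ V x) {x y : E}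
    (hdrift : ∫⁻ u, ENNReal.ofReal (V u) ∂P x + ∫⁻ u, ENNReal.ofReal (V u) ∂P y ≤
      ENNReal.ofReal (V x + V y - φ (V x + V y))) :
    ∫⁻ u, 2 * ENNReal.ofReal (V u) ∂P x + ∫⁻ u, 2 * ENNReal.ofReal (V u) ∂P y +
      2 * ENNReal.ofReal (φ 2) ≤ 2 * ENNReal.ofReal (V x) + 2 * ENNReal.ofReal (V y) := by
  have htwo : 2 ≤ V x + V y := by linarith [hV_one x, hV_one y]
  have hφ_le : φ 2 ≤ φ (V x + V y) :=
    hφ_mono (Set.mem_Ici.2 zero_le_two) (Set.mem_Ici.2 (zero_le_two.trans htwo)) htwo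
  have h := lintegral_add_lintegral_add_ofReal_le hV_one (hφ.trans hφ_le) hdrift
  rw [lintegral_const_mul _ hV.ennreal_ofReal, lintegral_const_mul _ hV.ennreal_ofReal,
    ← mul_add, ← mul_add, ← mul_add,
    ← ENNReal.ofReal_add (zero_le_one.trans (hV_one x)) (zero_le_one.trans (hV_one y))]
  gcongr
  exact (add_le_add le_rfl (ENNReal.ofReal_le_ofReal hφ_le)).trans h

lemma lintegral_two_mul_add_le_of_drift_self (hφ_nonneg : ∀ t, 0 ≤ t → 0 ≤ φ t)
    (hφ_mono : MonotoneOn φ (Set.Ici 0)) (hV : Measurable V) (hV_one : ∀ x, 1 ≤ V x) {x : E}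
    (hdrift : ∫⁻ u, ENNReal.ofReal (V u) ∂P x + ∫⁻ u, ENNReal.ofReal (V u) ∂P x ≤
      ENNReal.ofReal (V x + V x - φ (V x + V x) + b)) :
    ∫⁻ u, 2 * ENNReal.ofReal (V u) ∂P x + ENNReal.ofReal (φ (V x)) ≤
      2 * ENNReal.ofReal (V x) + ENNReal.ofReal b := by
  have hV_nonneg : 0 ≤ V x := zero_le_one.trans (hV_one x)
  have hφ_le : φ (V x) ≤ φ (V x + V x) :=
    hφ_mono (Set.mem_Ici.2 hV_nonneg) (Set.mem_Ici.2 (by positivity)) (by linarith)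
  rw [sub_add_eq_add_sub] at hdrift
  have h := lintegral_add_lintegral_add_ofReal_le hV_one (hφ_nonneg _ (by positivity)) hdrift
  rw [lintegral_const_mul _ hV.ennreal_ofReal, two_mul, two_mul,
    ← ENNReal.ofReal_add hV_nonneg hV_nonneg]
  exact (add_le_add le_rfl (ENNReal.ofReal_le_ofReal hφ_le)).trans (h.trans ENNReal.ofReal_add_le)

end RealValued

theorem mainTheorem2_general {E : Type*} [MetricSpace E] [CompleteSpace E]
    [SecondCountableTopology E] [Nonempty E] [MeasurableSpace E] [BorelSpace E] {D : ℝ}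
    (hd : ∀ x y : E, dist x y ≤ D) {P : Kernel E E} [IsMarkovKernel P]
    {Q : Kernel (E × E) (E × E)} (hQ : IsCouplingKernel P Q) {Δ : Set (E × E)} {ℓ : ℕ} {ε : ℝ}
    (hε : 0 < ε) (hweak : ∀ x y : E, ∫ z, dist z.1 z.2 ∂Q (x, y) ≤ dist x y)
    (hcontr : ∀ x y : E, (x, y) ∈ Δ → ∫ z, dist z.1 z.2 ∂(Q ^ ℓ) (x, y) ≤ (1 - ε) * dist x y)
    {φ : ℝ → ℝ} (hφ_nonneg : ∀ t, 0 ≤ t → 0 ≤ φ t) (hφ_mono : MonotoneOn φ (Set.Ici 0))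
    (hφ_pos : 0 < φ 2) (hφ_lim : Tendsto φ atTop atTop) {V : E → ℝ} (hV : Measurable V)
    (hV_one : ∀ x, 1 ≤ V x) {b : ℝ}
    (hdrift : ∀ x y : E,
      ∫⁻ z, ENNReal.ofReal (V z) ∂P x + ∫⁻ z, ENNReal.ofReal (V z) ∂P y ≤
        ENNReal.ofReal (V x + V y - φ (V x + V y) + b * Δ.indicator (fun _ => (1 : ℝ)) (x, y))) :
    ∃ π : Measure E,
      (IsProbabilityMeasure π ∧ P.Invariant π) ∧
      (∀ π' : Measure E, IsProbabilityMeasure π' → P.Invariant π' → π' = π) ∧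
      Integrable (fun x => φ (V x)) π := by
  have := hQ.isMarkovKernel
  have hW : Measurable fun x => 2 * ENNReal.ofReal (V x) := hV.ennreal_ofReal.const_mul 2
  have hφV : Measurable fun x => φ (V x) :=
    measurable_comp_of_monotoneOn_Ici hφ_mono hV fun x => zero_le_one.trans (hV_one x)
  have hdrift_self (x : E) : ∫⁻ u, 2 * ENNReal.ofReal (V u) ∂P x + ENNReal.ofReal (φ (V x)) ≤
      2 * ENNReal.ofReal (V x) + ENNReal.ofReal |b| := by
    refine lintegral_two_mul_add_le_of_drift_self hφ_nonneg hφ_mono hV hV_one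
      ((hdrift x x).trans (ENNReal.ofReal_le_ofReal (add_le_add le_rfl ?_)))
    by_cases hx : (x, x) ∈ Δ <;> simp [hx, le_abs_self]
  have hdrift_compl (x y : E) (hxy : (x, y) ∉ Δ) :
      ∫⁻ u, 2 * ENNReal.ofReal (V u) ∂P x + ∫⁻ u, 2 * ENNReal.ofReal (V u) ∂P y +
        2 * ENNReal.ofReal (φ 2) ≤ 2 * ENNReal.ofReal (V x) + 2 * ENNReal.ofReal (V y) :=
    lintegral_two_mul_add_le_of_drift hφ_mono hφ_pos.le hV hV_one
      (by simpa [hxy] using hdrift x y)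
  have hedist (x y : E) : edist x y ≤ ENNReal.ofReal D := by
    rw [edist_dist]
    exact ENNReal.ofReal_le_ofReal (hd x y)
  have hweak' (z : E × E) : ∫⁻ w, edist w.1 w.2 ∂Q z ≤ edist z.1 z.2 := by
    simpa using lintegral_edist_le_ofReal_mul_edist hd (r := 1) (by simpa using hweak z.1 z.2)
  have hcontr' (z : E × E) (hz : z ∈ Δ) :
      ∫⁻ w, edist w.1 w.2 ∂(Q ^ ℓ) z ≤ ENNReal.ofReal (1 - ε) * edist z.1 z.2 :=
    lintegral_edist_le_ofReal_mul_edist hd (hcontr z.1 z.2 hz)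
  obtain ⟨π, hπ, hπ_unique⟩ : ∃! π : ProbabilityMeasure E, P.Invariant (π : Measure E) :=
    hQ.existsUnique_invariant ENNReal.ofReal_ne_top hedist hweak'
      (ENNReal.ofReal_lt_one.2 (sub_lt_self 1 hε)) hcontr' hW (fun x => by finiteness)
      (by simpa using hφ_pos) (by finiteness) hdrift_compl hφV.ennreal_ofReal
      (tendsto_ofReal_comp_comap_nhds_top hφ_lim V) ENNReal.ofReal_ne_top hdrift_self
  have hφV_int : ∫⁻ x, ENNReal.ofReal (φ (V x)) ∂(π : Measure E) < ∞ :=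
    (lintegral_le_of_invariant_of_drift hπ hW (fun x => by finiteness) hφV.ennreal_ofReal
      hdrift_self).trans_lt ENNReal.ofReal_lt_top
  refine ⟨π, ⟨inferInstance, hπ⟩, fun π' hπ' hinv => ?_, hφV.aestronglyMeasurable, ?_⟩
  · exact congrArg Subtype.val (hπ_unique ⟨π', hπ'⟩ hinv)
  · rwa [hasFiniteIntegral_iff_ofReal
      (.of_forall fun x => hφ_nonneg _ (zero_le_one.trans (hV_one x)))]

theorem mainTheorem2 {E : Type*} [MetricSpace E] [CompleteSpace E] [SecondCountableTopology E]
    [Nonempty E] [MeasurableSpace E] [BorelSpace E]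
    (hd : ∀ x y : E, dist x y ≤ 1)
    (P : Kernel E E) [IsMarkovKernel P]
    (Q : Kernel (E × E) (E × E)) (hQ : IsCouplingKernel P Q)
    (Δ : Set (E × E)) (ℓ : ℕ) (ε : ℝ) (hA1 : ContractionCondition Q Δ ℓ ε)
    (φ : ℝ → ℝ) (V : E → ℝ) (b : ℝ) (hA2 : DoubleDrift P Δ φ V b) :
    ∃ π : Measure E,
      (IsProbabilityMeasure π ∧ P.Invariant π) ∧
      (∀ π' : Measure E, IsProbabilityMeasure π' → P.Invariant π' → π' = π) ∧
      Integrable (fun x => φ (V x)) π :=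
  mainTheorem2_general hd hQ hA1.eps_pos hA1.weak_contraction hA1.contraction hA2.rate.nonneg
    hA2.rate.monotoneOn (hA2.rate.pos two_pos) hA2.rate.tendsto_atTop hA2.measurable hA2.one_le
    hA2.drift
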